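/- **The model.** Let $C,S$ be finite sets of customer and server classes, $E\subset C\times S$ a bipartite graph, $S(U)=\{s:\exists c\in U,(c,s)\in E\}$ and $C(V)=\{c:\exists s\in V,(c,s)\in E\}$. A state is a pair $(x,y)\in\mathbb N^C\times\mathbb N^S$ of unmatched customers and servers with $\sum_c x_c=\sum_s y_s$ and $x_cy_s=0$ for all $(c,s)\in E$. At each time step a pair $(c,s)$ of law $\mu$ arrives, independently of the past. If the buffer contains customers of a class in $C(\{s\})$, the server $s$ departs with one of them, of a class chosen by the matching policy; likewise, if the buffer contains servers of a class in $S(\{c\})$, the customer $c$ departs with one of them, of a class chosen by the policy. If neither arrival can be matched with the buffer and $(c,s)\in E$, then $c$ and $s$ depart together. Arrivals that do not depart are added to the buffer. Under MS (Match the Shortest) the class is chosen uniformly among the available matchable classes with the smallest positive number of items in the buffer (independently for $c$ and for $s$ when both are matched with the buffer). Under the PR (priority) policy with matrices $A,B$ an arriving $c$ is matched with the available class $s'\in S(\{c\})$ with the largest $A_{cs'}$, and an arriving $s$ with the available class $c'\in C(\{s\})$ with the largest $B_{c's}$. The model is *stable* if the resulting Markov chain has a unique stationary probability measure $\pi$ and,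 for every initial law $\nu$, the Cesàro averages of $\nu P^n$ converge weakly to $\pi$ ($P$ is the transition matrix). The *stability region* of a policy is the set of all probability measures $\mu$ on $C\times S$ whose marginals $\mu_C,\mu_S$ have full support and for which the model is stable. NCond is the set of conditions $$\mu_C(U)<\mu_S(S(U))\ \ (\emptyset\ne U\subsetneq C),\qquad \mu_S(V)<\mu_C(C(V))\ \ (\emptyset\ne V\subsetneq S).$$ **Proposition.** Let $C=\{1,2,3\}$, $S=\{1',2',3'\}$ and $E=\{(1,2'),(1,3'),(2,1'),(2,2'),(3,1')\}$ (the NN graph). Consider either the MS policy or the PR policy with $$A=B=\begin{pmatrix}0&2&1\\2&1&0\\1&0&0\end{pmatrix}.$$ For each of these two policies the stability region is a proper subset of the set of probability measures $\mu$ on $C\times S$ whose marginals satisfy NCond. Explicitly, $\mu=\mu_C\times\mu_S$ with $\mu_C=\mu_S=(1/3,2/5,4/15)$ satisfies NCond, but the model is not stable under MS, and not stable under PR. -/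

import Mathlib

noncomputable section

namespace BipartiteMatching

section Model

variable {C S : Type*} [Fintype C] [Fintype S] [DecidableEq C] [DecidableEq S]

/-- `S(U)`: the server classes that can be matched with a customer class of `U`. -/
def serversOf (E : Finset (C × S)) (U : Finset C) : Finset S :=
  Finset.univ.filter fun s => ∃ c ∈ U, (c, s) ∈ E

/-- `C(V)`: the customer classes that can be matched with a server class of `V`. -/
def customersOf (E : Finset (C × S)) (V : Finset S) : Finset C :=
  Finset.univ.filter fun c => ∃ s ∈ V, (c, s) ∈ E

/-- The commutative state space of the matching graph `(C, S, E)`: `x c` unmatched customers of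
class `c` and `y s` unmatched servers of class `s`, equally many customers as servers in total,
and no possible match left in the buffer. -/
@[ext]
structure State (E : Finset (C × S)) where
  x : C → ℕ
  y : S → ℕ
  balanced : ∑ c, x c = ∑ s, y s
  unmatched : ∀ c s, (c, s) ∈ E → x c * y s = 0

/-- The classes of the customers in the buffer `x` that can be matched with an `s`-server. -/
def waitingC (E : Finset (C × S)) (x : C → ℕ) (s : S) : Finset C :=
  Finset.univ.filter fun c => (c, s) ∈ E ∧ 0 < x c

/-- The classes of the servers in the buffer `y` that can be matched with a `c`-customer. -/
def waitingS (E : Finset (C × S)) (y : S → ℕ) (c : C) : Finset S :=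
  Finset.univ.filter fun s => (c, s) ∈ E ∧ 0 < y s

/-- A (possibly randomized) admissible policy on the commutative state space: `Φ x s` is the law
of the class of the buffered customer with which an arriving `s`-server is matched, and `Ψ y c`
the law of the class of the buffered server with which an arriving `c`-customer is matched; they
are needed only when a match is available. -/
structure AdmissiblePolicy (E : Finset (C × S)) where
  Φ : ∀ (x : C → ℕ) (s : S), (waitingC E x s).Nonempty → PMF {c // c ∈ waitingC E x s}
  Ψ : ∀ (y : S → ℕ) (c : C), (waitingS E y c).Nonempty → PMF {s // s ∈ waitingS E y c}

theorem sum_add_single {ι : Type*} [Fintype ι] [DecidableEq ι] (f : ι → ℕ) (i : ι) :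
    ∑ j, (f + Pi.single i 1 : ι → ℕ) j = ∑ j, f j + 1 := by
  simp [Finset.sum_add_distrib]

theorem sub_single_add {ι : Type*} [DecidableEq ι] (f : ι → ℕ) (i : ι) (h : 0 < f i) :
    f - Pi.single i 1 + Pi.single i 1 = f := by
  funext j
  by_cases hj : j = i
  · subst hj; simp; omega
  · simp [hj]

theorem sum_sub_single {ι : Type*} [Fintype ι] [DecidableEq ι] (f : ι → ℕ) (i : ι)
    (h : 0 < f i) : ∑ j, (f - Pi.single i 1 : ι → ℕ) j + 1 = ∑ j, f j := by
  rw [← sum_add_single, sub_single_add f i h]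

theorem sub_single_eq_zero {ι : Type*} [DecidableEq ι] {f : ι → ℕ} (i : ι) {j : ι}
    (h : f j = 0) : (f - Pi.single i 1 : ι → ℕ) j = 0 := by
  simp [h]

namespace State

variable {E : Finset (C × S)}

/-- `(x + e_c, y + e_s)`: both arrivals are stored. -/
def store (z : State E) (c : C) (s : S) (hC : ¬ (waitingC E z.x s).Nonempty)
    (hS : ¬ (waitingS E z.y c).Nonempty) (hE : (c, s) ∉ E) : State E where
  x := z.x + Pi.single c 1
  y := z.y + Pi.single s 1
  balanced := by rw [sum_add_single, sum_add_single, z.balanced]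
  unmatched := by
    intro c' s' h
    have h1 := z.unmatched c' s' h
    have h2 : (c', s) ∈ E → z.x c' = 0 := fun h' => by
      by_contra h0
      exact hC ⟨c', by simp [waitingC, h', Nat.pos_of_ne_zero h0]⟩
    have h3 : (c, s') ∈ E → z.y s' = 0 := fun h' => by
      by_contra h0
      exact hS ⟨s', by simp [waitingS, h', Nat.pos_of_ne_zero h0]⟩
    by_cases hc : c' = c
    · subst hc
      have : s' ≠ s := by rintro rfl; exact hE h
      simp [this, h3 h]
    · by_cases hs : s' = s
      · subst hs
        simp [hc, h2 h]
      · simpa [hc, hs] using h1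

/-- `(x - e_c', y - e_s')`: both arrivals are matched with the buffer. -/
def matchBoth (z : State E) {c : C} {s : S} (c' : {c // c ∈ waitingC E z.x s})
    (s' : {s // s ∈ waitingS E z.y c}) : State E where
  x := z.x - Pi.single c'.1 1
  y := z.y - Pi.single s'.1 1
  balanced := by
    have hc : 0 < z.x c'.1 := (Finset.mem_filter.1 c'.2).2.2
    have hs : 0 < z.y s'.1 := (Finset.mem_filter.1 s'.2).2.2
    have h1 := sum_sub_single z.x c'.1 hc
    have h2 := sum_sub_single z.y s'.1 hs
    have h3 := z.balanced
    omega
  unmatched := by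
    intro a b h
    rcases Nat.mul_eq_zero.1 (z.unmatched a b h) with h0 | h0
    · rw [sub_single_eq_zero c'.1 h0, zero_mul]
    · rw [sub_single_eq_zero s'.1 h0, mul_zero]

/-- `(x - e_c' + e_c, y)`: the arriving server is matched, the arriving customer is stored. -/
def matchServer (z : State E) (c : C) {s : S} (c' : {c // c ∈ waitingC E z.x s})
    (hS : ¬ (waitingS E z.y c).Nonempty) : State E where
  x := z.x - Pi.single c'.1 1 + Pi.single c 1
  y := z.y
  balanced := by
    have hc : 0 < z.x c'.1 := (Finset.mem_filter.1 c'.2).2.2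
    rw [sum_add_single, sum_sub_single z.x c'.1 hc, z.balanced]
  unmatched := by
    intro a b h
    rcases Nat.mul_eq_zero.1 (z.unmatched a b h) with h0 | h0
    · by_cases ha : a = c
      · subst ha
        have : z.y b = 0 := by
          by_contra h1
          exact hS ⟨b, by simp [waitingS, h, Nat.pos_of_ne_zero h1]⟩
        rw [this, mul_zero]
      · simp [ha, h0]
    · rw [h0, mul_zero]

/-- `(x, y - e_s' + e_s)`: the arriving customer is matched, the arriving server is stored. -/
def matchCustomer (z : State E) {c : C} (s : S) (s' : {s // s ∈ waitingS E z.y c})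
    (hC : ¬ (waitingC E z.x s).Nonempty) : State E where
  x := z.x
  y := z.y - Pi.single s'.1 1 + Pi.single s 1
  balanced := by
    have hs : 0 < z.y s'.1 := (Finset.mem_filter.1 s'.2).2.2
    rw [sum_add_single, sum_sub_single z.y s'.1 hs, z.balanced]
  unmatched := by
    intro a b h
    rcases Nat.mul_eq_zero.1 (z.unmatched a b h) with h0 | h0
    · rw [h0, zero_mul]
    · by_cases hb : b = s
      · subst hb
        have : z.x a = 0 := by
          by_contra h1
          exact hC ⟨a, by simp [waitingC, h, Nat.pos_of_ne_zero h1]⟩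
        rw [this, zero_mul]
      · simp [hb, h0]

end State

/-- The law of the next state when the pair `a = (c, s)` arrives in the state `z`. When both
arrivals can be matched with the buffer, the two choices are made independently. -/
def step {E : Finset (C × S)} (pol : AdmissiblePolicy E) (z : State E) (a : C × S) :
    PMF (State E) :=
  if hC : (waitingC E z.x a.2).Nonempty then
    if hS : (waitingS E z.y a.1).Nonempty then
      (pol.Φ z.x a.2 hC).bind fun c' => (pol.Ψ z.y a.1 hS).map fun s' => z.matchBoth c' s'
    else
      (pol.Φ z.x a.2 hC).map fun c' => z.matchServer a.1 c' hS
  else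
    if hS : (waitingS E z.y a.1).Nonempty then
      (pol.Ψ z.y a.1 hS).map fun s' => z.matchCustomer a.2 s' hC
    else
      if hE : a ∈ E then PMF.pure z else PMF.pure (z.store a.1 a.2 hC hS hE)

/-- The transition kernel of the buffer content for i.i.d. arrivals of law `μ`. -/
def chain {E : Finset (C × S)} (pol : AdmissiblePolicy E) (μ : PMF (C × S)) (z : State E) :
    PMF (State E) :=
  μ.bind fun a => step pol z a

end Model

section MarkovChain

variable {X : Type*}

/-- The law `ν Pⁿ` at time `n` of the Markov chain with kernel `P` and initial law `ν`. -/
def lawAt (P : X → PMF X) (ν : PMF X) : ℕ → PMF X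
  | 0 => ν
  | n + 1 => (lawAt P ν n).bind P

/-- `π P = π`. -/
def IsStationary (P : X → PMF X) (π : PMF X) : Prop :=
  π.bind P = π

/-- The integral of a bounded function `f` against a discrete probability measure. -/
def expect (π : PMF X) (f : X → ℝ) : ℝ :=
  ∑' z, (π z).toReal * f z

/-- For every initial law `ν` the Cesàro averages of `ν Pⁿ` converge weakly to `π`. The state
space is discrete, so that every bounded function is a test function. -/
def IsAttractive (P : X → PMF X) (π : PMF X) : Prop :=
  ∀ (ν : PMF X) (f : X → ℝ), (∃ M : ℝ, ∀ z, |f z| ≤ M) →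
    Filter.Tendsto
      (fun n : ℕ => (n : ℝ)⁻¹ * ∑ k ∈ Finset.range n, expect (lawAt P ν k) f)
      Filter.atTop (nhds (expect π f))

/-- There is a unique stationary probability measure, and it is attractive. -/
def IsStable (P : X → PMF X) : Prop :=
  ∃ π : PMF X, IsStationary P π ∧ IsAttractive P π ∧ ∀ π' : PMF X, IsStationary P π' → π' = π

end MarkovChain

section Region

variable {C S : Type*} [Fintype C] [Fintype S] [DecidableEq C] [DecidableEq S]

/-- The conditions NCond on a pair of probability measures on `C` and on `S`. -/
def NCond (E : Finset (C × S)) (μC : PMF C) (μS : PMF S) : Prop :=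
  (∀ U : Finset C, U.Nonempty → U ≠ Finset.univ →
    ∑ c ∈ U, μC c < ∑ s ∈ serversOf E U, μS s) ∧
  (∀ V : Finset S, V.Nonempty → V ≠ Finset.univ →
    ∑ s ∈ V, μS s < ∑ c ∈ customersOf E V, μC c)

/-- The arrival laws whose marginals satisfy NCond. -/
def ncondRegion (E : Finset (C × S)) : Set (PMF (C × S)) :=
  {μ | NCond E (μ.map Prod.fst) (μ.map Prod.snd)}

/-- The arrival laws `μ`, with marginals of full support, for which the model is stable. -/
def stabilityRegion {E : Finset (C × S)} (pol : AdmissiblePolicy E) : Set (PMF (C × S)) :=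
  {μ | (μ.map Prod.fst).support = Set.univ ∧ (μ.map Prod.snd).support = Set.univ ∧
    IsStable (chain pol μ)}

end Region

section Policies

variable {C S : Type*} [Fintype C] [Fintype S] [DecidableEq C] [DecidableEq S]

/-- The points of a finite set `W` at which the function `f` is largest on `W`. -/
def argmax {ι : Type*} (W : Finset ι) (f : ι → ℤ) : Finset {i // i ∈ W} :=
  Finset.univ.filter fun i => ∀ j ∈ W, f j ≤ f i

theorem argmax_nonempty {ι : Type*} (W : Finset ι) (f : ι → ℤ) (h : W.Nonempty) :
    (argmax W f).Nonempty := by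
  obtain ⟨i, hi, hmax⟩ := W.exists_max_image f h
  exact ⟨⟨i, hi⟩, by simpa [argmax] using hmax⟩

/-- MS (Match the Shortest): the match is uniformly distributed on the available classes with the
least (positive) number of buffered items. -/
def matchShortest (E : Finset (C × S)) : AdmissiblePolicy E where
  Φ x s h := PMF.uniformOfFinset (argmax (waitingC E x s) fun c => -(x c : ℤ))
    (argmax_nonempty _ _ h)
  Ψ y c h := PMF.uniformOfFinset (argmax (waitingS E y c) fun s => -(y s : ℤ))
    (argmax_nonempty _ _ h)

/-- PR (Priorities): an arriving `c`-customer is matched with the available server class `s` with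
the greatest priority `A c s`, an arriving `s`-server with the available customer class `c` with
the greatest priority `B c s`. The match is deterministic when, as for the matrix `nnPriority`
below, the priorities of the possible matches of each class are distinct. -/
def priority (E : Finset (C × S)) (A B : Matrix C S ℕ) : AdmissiblePolicy E where
  Φ x s h := PMF.uniformOfFinset (argmax (waitingC E x s) fun c => (B c s : ℤ))
    (argmax_nonempty _ _ h)
  Ψ y c h := PMF.uniformOfFinset (argmax (waitingS E y c) fun s => (A c s : ℤ))
    (argmax_nonempty _ _ h)

end Policies

/-- The NN graph: the customer classes `1, 2, 3` and the server classes `1', 2', 3'` are both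
indexed by `0, 1, 2`; the edges are `(1,2'), (1,3'), (2,1'), (2,2'), (3,1')`. -/
def nnGraph : Finset (Fin 3 × Fin 3) :=
  {(0, 1), (0, 2), (1, 0), (1, 1), (2, 0)}

/-- The common value of the two priority matrices `A` and `B`. -/
def nnPriority : Matrix (Fin 3) (Fin 3) ℕ :=
  !![0, 2, 1;
     2, 1, 0;
     1, 0, 0]

/-- The probability measure `(1/3, 2/5, 4/15)` on three classes. -/
def nnMarginal : PMF (Fin 3) :=
  PMF.ofFintype (fun i => ENNReal.ofReal ((![1 / 3, 2 / 5, 4 / 15] : Fin 3 → ℝ) i)) (by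
    rw [← ENNReal.ofReal_sum_of_nonneg]
    · simp [Fin.sum_univ_three]; norm_num
    · intro i _; fin_cases i <;> simp <;> norm_num)

/-- The product `μ_C × μ_S` of two discrete probability measures. -/
def prodPMF {C S : Type*} (μC : PMF C) (μS : PMF S) : PMF (C × S) :=
  μC.bind fun c => μS.map fun s => (c, s)

end BipartiteMatching

end

open BipartiteMatching

/-! Stability fails as soon as there is a positive bounded superharmonic function with infimum zero,
and also as soon as some unbounded function of the state has upward jumps at least as likely as
downward ones. The second criterion, `not_isStable_of_drift`, gives NCond for every admissible
policy: for a customer set `U` whose neighbours all lie in `T`, no match lowers the excess of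
`U`-customers over `T`-servers.

The first criterion, `not_isStable_of_superharmonic`, gives the counterexample. Start with many
customers and servers of the third classes. Both policies then serve the second class before the
third (`PrefersSecond`), so the number `k` of waiting second-class items stays small, while the
number `m` of third-class items has mean drift `1/5` when `k > 0` and `-2/15` when `k = 0`. The law
of `k` gives enough weight to `k > 0` for `m` to grow on average, although NCond holds. The growth
is certified by `decay`, exponentially small in `m`: truncated at `1`, it is the superharmonic
function `escape`. -/

namespace BipartiteMatching

open scoped ENNReal

/-! ### Integrals of nonnegative functions against discrete laws. -/

section Mean

variable {X Y : Type*}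

/-- The integral of a nonnegative function against a discrete probability measure. -/
noncomputable def mean (p : PMF X) (h : X → ℝ≥0∞) : ℝ≥0∞ :=
  ∑' x, p x * h x

theorem mean_bind (p : PMF X) (f : X → PMF Y) (h : Y → ℝ≥0∞) :
    mean (p.bind f) h = mean p fun x => mean (f x) h := by
  simp only [mean, PMF.bind_apply, ← ENNReal.tsum_mul_right, ← ENNReal.tsum_mul_left]
  rw [ENNReal.tsum_comm]
  simp only [mul_assoc]

theorem mean_pure (x : X) (h : X → ℝ≥0∞) : mean (PMF.pure x) h = h x := by
  rw [mean, tsum_eq_single x]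
  · simp
  · intro y hy; simp [hy]

theorem mean_map (p : PMF X) (f : X → Y) (h : Y → ℝ≥0∞) :
    mean (p.map f) h = mean p fun x => h (f x) := by
  rw [PMF.map, mean_bind]
  simp [mean_pure]

theorem mean_const (p : PMF X) (b : ℝ≥0∞) : mean p (fun _ => b) = b := by
  rw [mean, ENNReal.tsum_mul_right, p.tsum_coe, one_mul]

theorem mean_le_mean (p : PMF X) {f g : X → ℝ≥0∞} (h : ∀ x ∈ p.support, f x ≤ g x) :
    mean p f ≤ mean p g := by
  refine ENNReal.tsum_le_tsum fun x => ?_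
  by_cases hx : p x = 0
  · simp [hx]
  · exact mul_le_mul_right (h x ((p.mem_support_iff x).2 hx)) _

theorem mean_le_of_le (p : PMF X) {f : X → ℝ≥0∞} {b : ℝ≥0∞} (h : ∀ x ∈ p.support, f x ≤ b) :
    mean p f ≤ b :=
  (mean_le_mean p h).trans_eq (mean_const p b)

theorem le_mean_of_le (p : PMF X) {f : X → ℝ≥0∞} {b : ℝ≥0∞} (h : ∀ x ∈ p.support, b ≤ f x) :
    b ≤ mean p f :=
  (mean_const p b).symm.trans_le (mean_le_mean p h)

theorem mean_add (p : PMF X) (f g : X → ℝ≥0∞) :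
    mean p (fun x => f x + g x) = mean p f + mean p g := by
  simp only [mean, mul_add, ENNReal.tsum_add]

theorem mean_const_mul (p : PMF X) (b : ℝ≥0∞) (f : X → ℝ≥0∞) :
    mean p (fun x => b * f x) = b * mean p f := by
  simp only [mean, ← ENNReal.tsum_mul_left, mul_left_comm]

theorem expect_toReal (p : PMF X) {h : X → ℝ≥0∞} (hh : ∀ x, h x ≤ 1) :
    expect p (fun x => (h x).toReal) = (mean p h).toReal := by
  rw [mean, ENNReal.tsum_toReal_eq]
  · simp [expect]
  · intro x
    exact ENNReal.mul_ne_top (p.apply_ne_top x) (ne_top_of_le_ne_top ENNReal.one_ne_top (hh x))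

theorem mean_eq_zero {p : PMF X} {h : X → ℝ≥0∞} (hp : mean p h = 0) :
    ∀ x ∈ p.support, h x = 0 := by
  intro x hx
  have := ENNReal.tsum_eq_zero.1 hp x
  exact (mul_eq_zero.1 this).resolve_left ((p.mem_support_iff x).1 hx)

end Mean

/-! ### Instability from bounded superharmonic functions. -/

section Superharmonic

variable {X : Type*} {P : X → PMF X} {h : X → ℝ≥0∞}

theorem mean_lawAt_le (hP : ∀ z, mean (P z) h ≤ h z) (z : X) (n : ℕ) :
    mean (lawAt P (PMF.pure z) n) h ≤ h z := by
  induction n with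
  | zero => exact (mean_pure z h).le
  | succ n ih =>
    rw [lawAt, mean_bind]
    exact (mean_le_mean _ fun x _ => hP x).trans ih

/-- Started from the point mass at `z`, the mean of `h` never exceeds `h z`; neither do its Cesàro
averages, nor their limit. -/
theorem IsAttractive.mean_le {π : PMF X} (hπ : IsAttractive P π) (h1 : ∀ z, h z ≤ 1)
    (hP : ∀ z, mean (P z) h ≤ h z) (z : X) : mean π h ≤ h z := by
  have hfin : ∀ z, h z ≠ ∞ := fun z => ne_top_of_le_ne_top ENNReal.one_ne_top (h1 z)
  have hb : ∃ M : ℝ, ∀ z, |(h z).toReal| ≤ M := by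
    refine ⟨1, fun z => ?_⟩
    rw [abs_of_nonneg ENNReal.toReal_nonneg]
    simpa using ENNReal.toReal_mono ENNReal.one_ne_top (h1 z)
  have hlim := hπ (PMF.pure z) (fun z => (h z).toReal) hb
  have hπ1 : mean π h ≤ 1 := mean_le_of_le π fun x _ => h1 x
  rw [expect_toReal π h1] at hlim
  rw [← ENNReal.toReal_le_toReal (ne_top_of_le_ne_top ENNReal.one_ne_top hπ1) (hfin z)]
  refine le_of_tendsto hlim (Filter.eventually_atTop.2 ⟨1, fun n hn => ?_⟩)
  have hn' : (0 : ℝ) < n := by exact_mod_cast hn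
  rw [inv_mul_le_iff₀ hn']
  calc ∑ k ∈ Finset.range n, expect (lawAt P (PMF.pure z) k) (fun z => (h z).toReal)
      ≤ ∑ k ∈ Finset.range n, (h z).toReal := by
        refine Finset.sum_le_sum fun k _ => ?_
        rw [expect_toReal _ h1]
        exact ENNReal.toReal_mono (hfin z) (mean_lawAt_le hP z k)
    _ = n * (h z).toReal := by simp

/-- A positive bounded superharmonic function whose infimum is zero rules out stability. -/
theorem not_isStable_of_superharmonic (h1 : ∀ z, h z ≤ 1) (h0 : ∀ z, h z ≠ 0)
    (hP : ∀ z, mean (P z) h ≤ h z) (hinf : ∀ ε : ℝ≥0∞, 0 < ε → ∃ z, h z < ε) :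
    ¬ IsStable P := by
  rintro ⟨π, -, hatt, -⟩
  have hπ : mean π h = 0 := by
    by_contra hne
    obtain ⟨z, hz⟩ := hinf _ (pos_iff_ne_zero.2 hne)
    exact absurd (hatt.mean_le h1 hP z) (not_le.2 hz)
  obtain ⟨x, hx⟩ := π.support_nonempty
  exact h0 x (mean_eq_zero hπ x hx)

end Superharmonic

/-! ### Instability from a nonnegative drift. -/

section Drift

variable {X A : Type*}

/-- A chain driven by i.i.d. arrivals of law `μ` is not stable if some unbounded integer function
of the state increases at least by a function `ξ ≥ -1` of the arrival which is at least as likely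
to be `1` as to be `-1`. -/
theorem not_isStable_of_drift (μ : PMF A) (st : X → A → PMF X) (d : X → ℤ) (ξ : A → ℤ)
    (hlow : ∀ a, -1 ≤ ξ a)
    (hstep : ∀ z a, ∀ z' ∈ (st z a).support, d z + ξ a ≤ d z')
    (hunb : ∀ k : ℤ, ∃ z, k ≤ d z)
    (hdrift : mean μ (fun a => if ξ a = -1 then 1 else 0) ≤
      mean μ (fun a => if ξ a = 1 then 1 else 0)) :
    ¬ IsStable fun z => μ.bind (st z) := by
  rintro ⟨π, hstat, hatt, -⟩
  set p := mean μ (fun a => if ξ a = 1 then (1 : ℝ≥0∞) else 0) with hp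
  have hp1 : p ≤ 1 := mean_le_of_le μ fun x _ => by split_ifs <;> simp
  have hpfin : p ≠ ∞ := ne_top_of_le_ne_top ENNReal.one_ne_top hp1
  obtain ⟨x₀, hx₀⟩ := π.support_nonempty
  by_cases hp0 : p = 0
  -- Here `d` almost surely never decreases, so the indicator of `d ≤ d x₀` is superharmonic. It
  -- vanishes at a state with larger `d`, hence `π`-almost everywhere, whereas `x₀` is in the
  -- support.
  · have hξ : ∀ a ∈ μ.support, 0 ≤ ξ a := by
      intro a ha
      have h0 := mean_eq_zero (le_antisymm (hdrift.trans_eq hp0) zero_le) a ha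
      have := hlow a
      by_contra hneg
      rw [if_pos (by omega)] at h0
      exact one_ne_zero h0
    obtain ⟨z, hz⟩ := hunb (d x₀ + 1)
    have hle := hatt.mean_le (h := fun z => if d z < d x₀ + 1 then 1 else 0)
      (fun z => by split_ifs <;> simp) (fun z => ?_) z
    · rw [if_neg (not_lt.2 hz)] at hle
      have := mean_eq_zero (le_antisymm hle zero_le) x₀ hx₀
      simp at this
    · refine mean_le_of_le _ fun z' hz' => ?_
      obtain ⟨a, ha, hz'⟩ := (PMF.mem_support_bind_iff _ _ _).1 hz'
      have h1 := hstep z a z' hz'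
      have h2 := hξ a ha
      split_ifs <;> first | (exfalso; omega) | simp
  -- Balance across the cut between `k` and `k + 1`: the upward flow is at least `p` times the mass
  -- of level `k`, while the downward flow starts at level `k + 1` only and is at most `p` times its
  -- mass. Hence the level masses are nondecreasing, which is absurd for a probability measure once
  -- one of them is positive.
  · have hmono : ∀ k : ℤ, mean π (fun z => if d z = k then 1 else 0) ≤
        mean π (fun z => if d z = k + 1 then 1 else 0) := by
      intro k
      set g : X → ℝ≥0∞ := fun z => if k < d z then 1 else 0 with hg
      have hpt : ∀ z, g z + p * (if d z = k then 1 else 0) ≤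
          mean (μ.bind (st z)) g + p * (if d z = k + 1 then 1 else 0) := by
        intro z
        rw [mean_bind]
        rcases lt_trichotomy (d z) k with hlt | heq | hgt
        · simp [hg, hlt.not_gt, hlt.ne]
        · have : p ≤ mean μ fun a => mean (st z a) g := by
            refine mean_le_mean μ fun a _ => ?_
            split_ifs with ha
            · refine le_mean_of_le _ fun z' hz' => ?_
              have := hstep z a z' hz'
              rw [hg]
              simp only
              rw [if_pos (by omega)]
            · exact zero_le
          simpa [hg, heq] using this
        · by_cases heq : d z = k + 1
          -- An arrival either keeps `d` above `k` or has `ξ = -1`; the latter has probability at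
          -- most `p` by `hdrift`.
          · have : 1 ≤ (mean μ fun a => mean (st z a) g) + p := by
              refine le_trans ?_ (add_le_add_right hdrift _)
              rw [← mean_add]
              refine le_mean_of_le _ fun a _ => ?_
              split_ifs with ha
              · simp
              · rw [add_zero]
                refine le_mean_of_le _ fun z' hz' => ?_
                have := hstep z a z' hz'
                have := hlow a
                rw [hg]
                simp only
                rw [if_pos (by omega)]
            simpa [hg, heq] using this
          · have : 1 ≤ (mean μ fun a => mean (st z a) g) := by
              refine le_mean_of_le _ fun a _ => le_mean_of_le _ fun z' hz' => ?_
              have := hstep z a z' hz'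
              have := hlow a
              rw [hg]
              simp only
              rw [if_pos (by omega)]
            simpa [hg, heq, hgt, hgt.ne'] using this
      have hsum := mean_le_mean π fun z _ => hpt z
      rw [mean_add, mean_add, mean_const_mul, mean_const_mul, ← mean_bind] at hsum
      rw [show π.bind (fun z => μ.bind (st z)) = π from hstat] at hsum
      have hgfin : mean π g ≠ ∞ := ne_top_of_le_ne_top ENNReal.one_ne_top
        (mean_le_of_le π fun z _ => by rw [hg]; simp only; split_ifs <;> simp)
      exact (ENNReal.mul_le_mul_iff_right hp0 hpfin).1 ((ENNReal.add_le_add_iff_left hgfin).1 hsum)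
    set m : ℕ → ℝ≥0∞ := fun n => mean π (fun z => if d z = d x₀ + n then 1 else 0) with hm
    have hm_mono : ∀ n, m 0 ≤ m n := by
      intro n
      induction n with
      | zero => exact le_rfl
      | succ n ih =>
        refine ih.trans ((hmono (d x₀ + n)).trans_eq ?_)
        simp only [hm, Nat.cast_succ, add_assoc]
    have hm0 : m 0 ≠ 0 := by
      intro h0
      have := mean_eq_zero h0 x₀ hx₀
      simp at this
    have hsum : ∑' n, m n ≤ 1 := by
      simp only [hm, mean]
      rw [ENNReal.tsum_comm]
      simp only [ENNReal.tsum_mul_left]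
      refine mean_le_of_le π fun z _ => ?_
      by_cases hz : d x₀ ≤ d z
      · rw [tsum_eq_single (d z - d x₀).toNat]
        · split_ifs <;> simp
        · intro n hn
          rw [if_neg (by omega)]
      · rw [ENNReal.tsum_eq_zero.2]
        · simp
        · intro n
          rw [if_neg (by omega)]
    have htop : ∑' _ : ℕ, m 0 = ∞ := ENNReal.tsum_const_eq_top_of_ne_zero hm0
    have := (ENNReal.tsum_le_tsum hm_mono).trans hsum
    rw [htop] at this
    simp at this

end Drift

/-! ### NCond is necessary under every admissible policy. -/

section Necessity

variable {C S : Type*} [Fintype C] [Fintype S] [DecidableEq C] [DecidableEq S]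
  {E : Finset (C × S)}

/-- The possible transitions when the pair `(c, s)` arrives. -/
theorem mem_support_step {pol : AdmissiblePolicy E} {z z' : State E} {c : C} {s : S}
    (h : z' ∈ (step pol z (c, s)).support) :
    (∃ hC hS, ∃ c' ∈ (pol.Φ z.x s hC).support, ∃ s' ∈ (pol.Ψ z.y c hS).support,
      z'.x = z.x - Pi.single c'.1 1 ∧ z'.y = z.y - Pi.single s'.1 1) ∨
    (∃ hC, ¬ (waitingS E z.y c).Nonempty ∧ ∃ c' ∈ (pol.Φ z.x s hC).support,
      z'.x = z.x - Pi.single c'.1 1 + Pi.single c 1 ∧ z'.y = z.y) ∨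
    (∃ hS, ¬ (waitingC E z.x s).Nonempty ∧ ∃ s' ∈ (pol.Ψ z.y c hS).support,
      z'.x = z.x ∧ z'.y = z.y - Pi.single s'.1 1 + Pi.single s 1) ∨
    (¬ (waitingC E z.x s).Nonempty ∧ ¬ (waitingS E z.y c).Nonempty ∧ (c, s) ∈ E ∧
      z'.x = z.x ∧ z'.y = z.y) ∨
    (¬ (waitingC E z.x s).Nonempty ∧ ¬ (waitingS E z.y c).Nonempty ∧ (c, s) ∉ E ∧
      z'.x = z.x + Pi.single c 1 ∧ z'.y = z.y + Pi.single s 1) := by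
  unfold step at h
  split_ifs at h with hC hS hS hE
  · obtain ⟨c', hc', h⟩ := (PMF.mem_support_bind_iff _ _ _).1 h
    obtain ⟨s', hs', rfl⟩ := (PMF.mem_support_map_iff _ _ _).1 h
    exact Or.inl ⟨hC, hS, c', hc', s', hs', rfl, rfl⟩
  · obtain ⟨c', hc', rfl⟩ := (PMF.mem_support_map_iff _ _ _).1 h
    exact Or.inr (Or.inl ⟨hC, hS, c', hc', rfl, rfl⟩)
  · obtain ⟨s', hs', rfl⟩ := (PMF.mem_support_map_iff _ _ _).1 h
    exact Or.inr (Or.inr (Or.inl ⟨hS, hC, s', hs', rfl, rfl⟩))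
  · obtain rfl := (PMF.mem_support_pure_iff _ _).1 h
    exact Or.inr (Or.inr (Or.inr (Or.inl ⟨hC, hS, hE, rfl, rfl⟩)))
  · obtain rfl := (PMF.mem_support_pure_iff _ _).1 h
    exact Or.inr (Or.inr (Or.inr (Or.inr ⟨hC, hS, hE, rfl, rfl⟩)))

/-- The number of buffered customers of the classes `U` minus the number of buffered servers of
the classes `T`. -/
def imbalance (U : Finset C) (T : Finset S) (z : State E) : ℤ :=
  ((∑ c ∈ U, z.x c : ℕ) : ℤ) - (∑ s ∈ T, z.y s : ℕ)

theorem sum_add_single_mem {ι : Type*} [DecidableEq ι] (U : Finset ι) (f : ι → ℕ) (i : ι) :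
    ∑ j ∈ U, (f + Pi.single i 1 : ι → ℕ) j = ∑ j ∈ U, f j + if i ∈ U then 1 else 0 := by
  simp [Finset.sum_add_distrib]

theorem sum_sub_single_mem {ι : Type*} [DecidableEq ι] (U : Finset ι) (f : ι → ℕ) (i : ι)
    (h : 0 < f i) :
    ∑ j ∈ U, (f - Pi.single i 1 : ι → ℕ) j + (if i ∈ U then 1 else 0) = ∑ j ∈ U, f j := by
  rw [← sum_add_single_mem, sub_single_add f i h]

/-- The arrivals alone contribute the stated increment. A departing matched pair that takes a
customer from `U` also takes a server from `T`, so departures cannot lower the imbalance. -/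
theorem imbalance_step {U : Finset C} {T : Finset S} (hUT : ∀ c ∈ U, ∀ s, (c, s) ∈ E → s ∈ T)
    (pol : AdmissiblePolicy E) (z : State E) (a : C × S) (z' : State E)
    (h : z' ∈ (step pol z a).support) :
    imbalance U T z + ((if a.1 ∈ U then 1 else 0) - if a.2 ∈ T then 1 else 0) ≤
      imbalance U T z' := by
  obtain ⟨c, s⟩ := a
  have key : ∀ c s, (c, s) ∈ E → (if c ∈ U then (1 : ℕ) else 0) ≤ if s ∈ T then 1 else 0 := by
    intro c s hcs
    by_cases hc : c ∈ U
    · simp [hc, hUT c hc s hcs]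
    · simp [hc]
  have cast_ite : ∀ (p : Prop) [Decidable p],
      (if p then (1 : ℤ) else 0) = ((if p then 1 else 0 : ℕ) : ℤ) := by
    intro p _; split_ifs <;> rfl
  simp only [cast_ite, imbalance]
  have hwC : ∀ c' : {c // c ∈ waitingC E z.x s}, (c'.1, s) ∈ E ∧ 0 < z.x c'.1 :=
    fun c' => (Finset.mem_filter.1 c'.2).2
  have hwS : ∀ s' : {s // s ∈ waitingS E z.y c}, (c, s'.1) ∈ E ∧ 0 < z.y s'.1 :=
    fun s' => (Finset.mem_filter.1 s'.2).2
  rcases mem_support_step h with ⟨_, _, c', _, s', _, hx, hy⟩ | ⟨_, _, c', _, hx, hy⟩ |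
    ⟨_, _, s', _, hx, hy⟩ | ⟨_, _, hE, hx, hy⟩ | ⟨_, _, _, hx, hy⟩
  · have h1 := sum_sub_single_mem U z.x c'.1 (hwC c').2
    have h2 := sum_sub_single_mem T z.y s'.1 (hwS s').2
    have h3 := key _ _ (hwC c').1
    have h4 := key _ _ (hwS s').1
    rw [hx, hy]
    omega
  · have h1 := sum_sub_single_mem U z.x c'.1 (hwC c').2
    have h3 := key _ _ (hwC c').1
    rw [hx, hy, sum_add_single_mem]
    omega
  · have h2 := sum_sub_single_mem T z.y s'.1 (hwS s').2
    have h4 := key _ _ (hwS s').1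
    rw [hx, hy, sum_add_single_mem]
    omega
  · have := key _ _ hE
    rw [hx, hy]
    omega
  · rw [hx, hy, sum_add_single_mem, sum_add_single_mem]
    omega

theorem sum_eq_mean_indicator {A B : Type*} [Fintype B] [DecidableEq B] (μ : PMF A) (f : A → B)
    (U : Finset B) : ∑ b ∈ U, (μ.map f) b = mean μ fun a => if f a ∈ U then 1 else 0 := by
  have : mean (μ.map f) (fun b => if b ∈ U then 1 else 0) = ∑ b ∈ U, (μ.map f) b := by
    rw [mean, tsum_fintype]
    simp
  rw [← this, mean_map]

theorem not_isStable_of_closed {U : Finset C} {T : Finset S}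
    (hUT : ∀ c ∈ U, ∀ s, (c, s) ∈ E → s ∈ T) (hU : U.Nonempty) (hT : T ≠ Finset.univ)
    (pol : AdmissiblePolicy E) (μ : PMF (C × S))
    (hμ : ∑ s ∈ T, (μ.map Prod.snd) s ≤ ∑ c ∈ U, (μ.map Prod.fst) c) :
    ¬ IsStable (chain pol μ) := by
  refine not_isStable_of_drift μ (step pol) (imbalance U T)
    (fun a => (if a.1 ∈ U then 1 else 0) - if a.2 ∈ T then 1 else 0) ?_
    (imbalance_step hUT pol) ?_ ?_
  · intro a
    split_ifs <;> norm_num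
  · intro k
    obtain ⟨c, hc⟩ := hU
    obtain ⟨s, hs⟩ : ∃ s, s ∉ T := by
      by_contra hall
      push Not at hall
      exact hT (Finset.eq_univ_iff_forall.2 hall)
    have hcs : (c, s) ∉ E := fun h => hs (hUT c hc s h)
    -- Equally many customers of a class in `U` and servers of a class outside `T`: these are
    -- incompatible, and only the customers count.
    refine ⟨⟨Pi.single c k.toNat, Pi.single s k.toNat, by simp, fun c' s' h => ?_⟩, ?_⟩
    · by_cases h1 : c' = c
      · have : s' ≠ s := by rintro rfl; exact hcs (h1 ▸ h)
        simp [this]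
      · simp [h1]
    · simp only [imbalance, Finset.sum_pi_single', hc, hs, if_true, if_false]
      omega
  · rw [sum_eq_mean_indicator, sum_eq_mean_indicator] at hμ
    -- Adding the mass of `U × T` to both sides turns the two jump probabilities into the marginal
    -- masses of `T` and `U`.
    set q : ℝ≥0∞ := mean μ fun a => if a.1 ∈ U ∧ a.2 ∈ T then 1 else 0 with hq
    have hqfin : q ≠ ∞ := ne_top_of_le_ne_top ENNReal.one_ne_top
      (mean_le_of_le μ fun a _ => by split_ifs <;> simp)
    refine (ENNReal.add_le_add_iff_right hqfin).1 ?_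
    rw [hq, ← mean_add, ← mean_add]
    convert hμ using 3
    · rename_i a
      by_cases h1 : a.1 ∈ U <;> by_cases h2 : a.2 ∈ T <;> simp [h1, h2]
    · rename_i a
      by_cases h1 : a.1 ∈ U <;> by_cases h2 : a.2 ∈ T <;> simp [h1, h2]

/-- A class outside `U` has positive mass and would push the total above `1`. This excludes the
degenerate case where the neighbourhood in NCond is everything. -/
theorem eq_univ_of_one_le {B : Type*} [Fintype B] [DecidableEq B] {ν : PMF B}
    (hν : ν.support = Set.univ) {U : Finset B} (h : 1 ≤ ∑ b ∈ U, ν b) : U = Finset.univ := by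
  refine Finset.eq_univ_iff_forall.2 fun b => ?_
  by_contra hb
  have h1 : ∑ i ∈ insert b U, ν i ≤ 1 := by
    rw [← ν.tsum_coe]
    exact ENNReal.sum_le_tsum _
  rw [Finset.sum_insert hb] at h1
  have hb0 : ν b ≠ 0 := (ν.mem_support_iff b).1 (hν ▸ Set.mem_univ b)
  have : ν b + ∑ i ∈ U, ν i ≤ 0 + ∑ i ∈ U, ν i := by simpa using h1.trans h
  have hfin : ∑ i ∈ U, ν i ≠ ∞ :=
    ne_top_of_le_ne_top ENNReal.one_ne_top (le_add_self.trans h1)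
  exact hb0 (le_antisymm ((ENNReal.add_le_add_iff_right hfin).1 this) zero_le)

theorem sum_univ_eq_one {B : Type*} [Fintype B] (ν : PMF B) : ∑ b, ν b = 1 := by
  rw [← ν.tsum_coe, tsum_fintype]

theorem sum_compl_add {B : Type*} [Fintype B] [DecidableEq B] (ν : PMF B) (U : Finset B) :
    ∑ b ∈ Uᶜ, ν b + ∑ b ∈ U, ν b = 1 := by
  rw [Finset.sum_compl_add_sum, sum_univ_eq_one]

/-- The conditions NCond are necessary for stability, under every admissible policy. -/
theorem stabilityRegion_subset_ncondRegion (pol : AdmissiblePolicy E) :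
    stabilityRegion pol ⊆ ncondRegion E := by
  rintro μ ⟨hC, hS, hstab⟩
  refine ⟨fun U hU hne => ?_, fun V hV hne => ?_⟩
  · by_contra hlt
    rw [not_lt] at hlt
    refine not_isStable_of_closed (U := U) (T := serversOf E U) ?_ hU ?_ pol μ hlt hstab
    · intro c hc s hcs
      exact Finset.mem_filter.2 ⟨Finset.mem_univ _, c, hc, hcs⟩
    · intro h
      rw [h, sum_univ_eq_one] at hlt
      exact hne (eq_univ_of_one_le hC hlt)
  · by_contra hlt
    rw [not_lt] at hlt
    -- The condition on `V` is the customer condition for complements: a customer class with no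
    -- neighbour in `V` has all its neighbours in `Vᶜ`.
    refine not_isStable_of_closed (U := (customersOf E V)ᶜ) (T := Vᶜ) ?_ ?_ ?_ pol μ ?_ hstab
    · intro c hc s hcs
      rw [Finset.mem_compl] at hc ⊢
      exact fun hs => hc (Finset.mem_filter.2 ⟨Finset.mem_univ _, s, hs, hcs⟩)
    · rw [Finset.nonempty_iff_ne_empty]
      intro h
      rw [Finset.compl_eq_empty_iff] at h
      rw [h, sum_univ_eq_one] at hlt
      exact hne (eq_univ_of_one_le hS hlt)
    · obtain ⟨s, hs⟩ := hV
      intro h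
      have := Finset.mem_univ s
      rw [← h, Finset.mem_compl] at this
      exact this hs
    · have h1 := sum_compl_add (μ.map Prod.fst) (customersOf E V)
      have h2 := sum_compl_add (μ.map Prod.snd) V
      have hfin : ∑ b ∈ V, (μ.map Prod.snd) b ≠ ∞ :=
        ne_top_of_le_ne_top ENNReal.one_ne_top (h2 ▸ le_add_self)
      refine (ENNReal.add_le_add_iff_right hfin).1 ?_
      rw [h2, ← h1]
      exact add_le_add_right hlt _

end Necessity

/-! ### The marginals `(5, 6, 4) / 15` satisfy NCond. -/

section Marginal

theorem prodPMF_map_fst {C S : Type*} (p : PMF C) (q : PMF S) :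
    (prodPMF p q).map Prod.fst = p := by
  have h (c : C) : (fun s : S => (Prod.mk c s).1) = Function.const S c := rfl
  simp [prodPMF, PMF.map_bind, PMF.map_comp, Function.comp_def, h, PMF.map_const]

theorem prodPMF_map_snd {C S : Type*} (p : PMF C) (q : PMF S) :
    (prodPMF p q).map Prod.snd = q := by
  simp only [prodPMF, PMF.map_bind, PMF.map_comp, Function.comp_def, PMF.bind_const]
  exact q.map_id

theorem nnMarginal_apply (i : Fin 3) :
    nnMarginal i = ((![5, 6, 4] : Fin 3 → ℕ) i : ℝ≥0∞) / 15 := by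
  have h : nnMarginal i = ENNReal.ofReal ((![1 / 3, 2 / 5, 4 / 15] : Fin 3 → ℝ) i) := rfl
  have h15 : (15 : ℝ≥0∞) = ENNReal.ofReal 15 := by simp
  rw [h, h15, ← ENNReal.ofReal_natCast, ← ENNReal.ofReal_div_of_pos (by norm_num)]
  congr 1
  fin_cases i <;> simp <;> norm_num

theorem sum_nnMarginal (U : Finset (Fin 3)) :
    ∑ i ∈ U, nnMarginal i = ((∑ i ∈ U, (![5, 6, 4] : Fin 3 → ℕ) i : ℕ) : ℝ≥0∞) / 15 := by
  simp only [nnMarginal_apply, ENNReal.div_eq_inv_mul, ← Finset.mul_sum, Nat.cast_sum]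

/-- Clearing the denominator makes NCond a decidable statement about natural numbers. -/
theorem sum_nnMarginal_lt_iff {U V : Finset (Fin 3)} :
    ∑ i ∈ U, nnMarginal i < ∑ i ∈ V, nnMarginal i ↔
      ∑ i ∈ U, (![5, 6, 4] : Fin 3 → ℕ) i < ∑ i ∈ V, (![5, 6, 4] : Fin 3 → ℕ) i := by
  rw [sum_nnMarginal, sum_nnMarginal, ENNReal.div_lt_div_iff_left (by simp) (by simp),
    Nat.cast_lt]

theorem prodPMF_nnMarginal_mem_ncondRegion :
    prodPMF nnMarginal nnMarginal ∈ ncondRegion nnGraph := by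
  change NCond _ _ _
  rw [prodPMF_map_fst, prodPMF_map_snd]
  simp only [NCond, sum_nnMarginal_lt_iff]
  decide

end Marginal

/-! ### Dynamics in the region where third-class items dominate. -/

section Escape

/-- The region of the state space in which only items of the second and third classes wait, those
of the second class being the less numerous. -/
def InRegion (z : State nnGraph) : Prop :=
  z.x 0 = 0 ∧ z.y 0 = 0 ∧ z.x 1 < z.x 2 ∧ z.y 1 < z.y 2

/-- The policy matches the second class rather than the third one whenever the second class is
available and the less numerous. -/
def PrefersSecond (pol : AdmissiblePolicy nnGraph) : Prop :=
  (∀ x s h, ∀ c ∈ (pol.Φ x s h).support, x 0 = 0 → 0 < x 1 → x 1 < x 2 → c.1 = 1) ∧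
  (∀ y c h, ∀ s ∈ (pol.Ψ y c h).support, y 0 = 0 → 0 < y 1 → y 1 < y 2 → s.1 = 1)

theorem mem_support_uniform_argmax {ι : Type*} {W : Finset ι} {f : ι → ℤ}
    (h : (argmax W f).Nonempty) {i : {i // i ∈ W}}
    (hi : i ∈ (PMF.uniformOfFinset (argmax W f) h).support) : ∀ j ∈ W, f j ≤ f i.1 := by
  rw [PMF.mem_support_uniformOfFinset_iff] at hi
  exact (Finset.mem_filter.1 hi).2

theorem mem_waitingC_nnGraph {x : Fin 3 → ℕ} {s c : Fin 3} :
    c ∈ waitingC nnGraph x s ↔ (c, s) ∈ nnGraph ∧ 0 < x c := by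
  simp [waitingC]

theorem mem_waitingS_nnGraph {y : Fin 3 → ℕ} {s c : Fin 3} :
    s ∈ waitingS nnGraph y c ↔ (c, s) ∈ nnGraph ∧ 0 < y s := by
  simp [waitingS]

/-- With no first-class item waiting, only an arrival of the opposite first class has a choice,
between the second and the third class; the shorter queue is the second. -/
theorem prefersSecond_matchShortest : PrefersSecond (matchShortest nnGraph) := by
  constructor
  · rintro x s h ⟨c, hc⟩ hsup h0 h1 h2
    have hmax := mem_support_uniform_argmax (argmax_nonempty _ _ h) hsup 1
    rw [mem_waitingC_nnGraph] at hc hmax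
    fin_cases c <;> fin_cases s <;> simp_all [nnGraph]
    omega
  · rintro y c h ⟨s, hs⟩ hsup h0 h1 h2
    have hmax := mem_support_uniform_argmax (argmax_nonempty _ _ h) hsup 1
    rw [mem_waitingS_nnGraph] at hs hmax
    fin_cases s <;> fin_cases c <;> simp_all [nnGraph]
    omega

theorem prefersSecond_priority :
    PrefersSecond (priority nnGraph nnPriority nnPriority) := by
  constructor
  · rintro x s h ⟨c, hc⟩ hsup h0 h1 h2
    have hmax := mem_support_uniform_argmax (argmax_nonempty _ _ h) hsup 1
    rw [mem_waitingC_nnGraph] at hc hmax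
    fin_cases c <;> fin_cases s <;> simp_all [nnGraph, nnPriority]
  · rintro y c h ⟨s, hs⟩ hsup h0 h1 h2
    have hmax := mem_support_uniform_argmax (argmax_nonempty _ _ h) hsup 1
    rw [mem_waitingS_nnGraph] at hs hmax
    fin_cases s <;> fin_cases c <;> simp_all [nnGraph, nnPriority]

/-- The number of buffered items of the third classes. -/
def numThird (z : State nnGraph) : ℤ := z.x 2 + z.y 2

/-- The number of buffered items of the second classes. -/
def numSecond (z : State nnGraph) : ℤ := z.x 1 + z.y 1

/-- An arriving first-class item always finds a third-class item to match, so first classes stay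
empty. The margin `3` absorbs one step: the second class may gain one item while the third loses
one. In the last case, two second-class arrivals leave together, whence the absolute value. -/
theorem step_of_inRegion {pol : AdmissiblePolicy nnGraph} (hpol : PrefersSecond pol)
    {z z' : State nnGraph} (hz : InRegion z) (hx : z.x 1 + z.y 1 + 3 ≤ z.x 2)
    (hy : z.x 1 + z.y 1 + 3 ≤ z.y 2) {c s : Fin 3}
    (h : z' ∈ (step pol z (c, s)).support) :
    InRegion z' ∧
    (0 < z.x 1 → numThird z' = numThird z + (![-1, 0, 1] c + ![0, 0, 1] s) ∧
      numSecond z' = numSecond z + (![0, 1, 0] c + ![-1, -1, 0] s)) ∧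
    (0 < z.y 1 → numThird z' = numThird z + (![0, 0, 1] c + ![-1, 0, 1] s) ∧
      numSecond z' = numSecond z + (![-1, -1, 0] c + ![0, 1, 0] s)) ∧
    (z.x 1 = 0 → z.y 1 = 0 → numThird z' = numThird z + (![-1, 0, 1] c + ![-1, 0, 1] s) ∧
      numSecond z' = |![0, 1, 0] c - ![0, 1, 0] s|) := by
  obtain ⟨hx0, hy0, hx12, hy12⟩ := hz
  have hxy : z.x 1 = 0 ∨ z.y 1 = 0 :=
    Nat.mul_eq_zero.1 (z.unmatched 1 1 (by decide))
  have hnC : ¬ (waitingC nnGraph z.x s).Nonempty → ∀ c', (c', s) ∈ nnGraph → z.x c' = 0 := by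
    intro hn c' hc'
    by_contra h0
    exact hn ⟨c', mem_waitingC_nnGraph.2 ⟨hc', Nat.pos_of_ne_zero h0⟩⟩
  have hnS : ¬ (waitingS nnGraph z.y c).Nonempty → ∀ s', (c, s') ∈ nnGraph → z.y s' = 0 := by
    intro hn s' hs'
    by_contra h0
    exact hn ⟨s', mem_waitingS_nnGraph.2 ⟨hs', Nat.pos_of_ne_zero h0⟩⟩
  have hΦ : ∀ hC, ∀ c' ∈ (pol.Φ z.x s hC).support,
      ((c'.1, s) ∈ nnGraph ∧ 0 < z.x c'.1) ∧ (0 < z.x 1 → c'.1 = 1) := fun hC c' hc' =>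
    ⟨mem_waitingC_nnGraph.1 c'.2, fun h1 => hpol.1 _ _ _ c' hc' hx0 h1 hx12⟩
  have hΨ : ∀ hS, ∀ s' ∈ (pol.Ψ z.y c hS).support,
      ((c, s'.1) ∈ nnGraph ∧ 0 < z.y s'.1) ∧ (0 < z.y 1 → s'.1 = 1) := fun hS s' hs' =>
    ⟨mem_waitingS_nnGraph.1 s'.2, fun h1 => hpol.2 _ _ _ s' hs' hy0 h1 hy12⟩
  unfold InRegion numThird numSecond
  rcases mem_support_step h with ⟨hC, hS, c', hc', s', hs', hx', hy'⟩ |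
    ⟨hC, hS, c', hc', hx', hy'⟩ | ⟨hS, hC, s', hs', hx', hy'⟩ | ⟨hC, hS, hE, hx', hy'⟩ |
    ⟨hC, hS, hE, hx', hy'⟩
  · obtain ⟨⟨h1, h2⟩, h3⟩ := hΦ _ _ hc'
    obtain ⟨⟨h4, h5⟩, h6⟩ := hΨ _ _ hs'
    rw [hx', hy']
    generalize c'.1 = i at *
    generalize s'.1 = j at *
    clear hΦ hΨ hnC hnS hc' hs' hx' hy' h
    fin_cases s <;> fin_cases i <;> simp [nnGraph] at h1 h2 h3 <;> try omega
    all_goals fin_cases c <;> fin_cases j <;> simp [nnGraph] at h4 h5 h6 <;> try omega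
    all_goals simp; omega
  · obtain ⟨⟨h1, h2⟩, h3⟩ := hΦ _ _ hc'
    have h4 := hnS hS 0
    have h5 := hnS hS 1
    have h6 := hnS hS 2
    rw [hx', hy']
    generalize c'.1 = i at *
    clear hΦ hΨ hnC hnS hc' hx' hy' h
    fin_cases s <;> fin_cases i <;> simp [nnGraph] at h1 h2 h3 <;> try omega
    all_goals fin_cases c <;> simp [nnGraph] at h4 h5 h6 <;> try omega
    all_goals simp; omega
  · obtain ⟨⟨h1, h2⟩, h3⟩ := hΨ _ _ hs'
    have h4 := hnC hC 0
    have h5 := hnC hC 1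
    have h6 := hnC hC 2
    rw [hx', hy']
    generalize s'.1 = i at *
    clear hΦ hΨ hnC hnS hs' hx' hy' h
    fin_cases c <;> fin_cases i <;> simp [nnGraph] at h1 h2 h3 <;> try omega
    all_goals fin_cases s <;> simp [nnGraph] at h4 h5 h6 <;> try omega
    all_goals simp; omega
  · have h1 := hnC hC 0
    have h2 := hnC hC 1
    have h3 := hnC hC 2
    have h4 := hnS hS 0
    have h5 := hnS hS 1
    have h6 := hnS hS 2
    rw [hx', hy']
    clear hΦ hΨ hnC hnS hx' hy' h
    fin_cases s <;> simp [nnGraph] at h1 h2 h3 <;> try omega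
    all_goals fin_cases c <;> simp [nnGraph] at h4 h5 h6 hE <;> try omega
    all_goals simp; omega
  · have h1 := hnC hC 0
    have h2 := hnC hC 1
    have h3 := hnC hC 2
    have h4 := hnS hS 0
    have h5 := hnS hS 1
    have h6 := hnS hS 2
    rw [hx', hy']
    clear hΦ hΨ hnC hnS hx' hy' h
    fin_cases s <;> simp [nnGraph] at h1 h2 h3 <;> try omega
    all_goals fin_cases c <;> simp [nnGraph] at h4 h5 h6 hE <;> try omega
    all_goals simp; omega

/-! ### The exponential superharmonic function. -/

/-- A function of the numbers `m` and `k` of items of the third and second classes, decaying in `m`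
and superharmonic for the chain inside the region. -/
noncomputable def decay (m k : ℤ) : ℝ :=
  250 * ((19 / 20) ^ m * ((39 / 40) ^ k + 2 ^ k / 200))

theorem decay_pos (m k : ℤ) : 0 < decay m k := by
  unfold decay; positivity

/-- With `decay` split into two exponentials, a one-step mean only multiplies each by a constant,
and superharmonicity for `k > 0` can be checked term by term. -/
theorem decay_add (m k i j : ℤ) :
    decay (m + i) (k + j) = 250 * ((19 / 20) ^ m * (39 / 40) ^ k) * ((19 / 20) ^ i * (39 / 40) ^ j)
      + 250 * ((19 / 20) ^ m * 2 ^ k) * ((19 / 20) ^ i * 2 ^ j / 200) := by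
  unfold decay
  rw [zpow_add₀ (by norm_num), zpow_add₀ (by norm_num), zpow_add₀ (by norm_num)]
  ring

/-- The `2 ^ k` term is there for this bound: it beats the decay in `m` along `m = 3 * k + 4`
because `(19/20)^3 * 2 > 1`, and the prefactor suffices because `250 / 200 * (19/20)^4 > 1`. -/
theorem one_le_decay {m k : ℕ} (h : m ≤ 3 * k + 4) : 1 ≤ decay m k := by
  unfold decay
  rw [zpow_natCast, zpow_natCast, zpow_natCast]
  have h1 : ((19 : ℝ) / 20) ^ (3 * k + 4) ≤ (19 / 20) ^ m :=
    pow_le_pow_of_le_one (by norm_num) (by norm_num) h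
  have h2 : (1 : ℝ) ≤ ((19 / 20) ^ 3 * 2) ^ k := one_le_pow₀ (by norm_num)
  have h3 : ((19 : ℝ) / 20) ^ (3 * k + 4) * 2 ^ k = (19 / 20) ^ 4 * ((19 / 20) ^ 3 * 2) ^ k := by
    rw [mul_pow, ← pow_mul, pow_add]; ring
  have h4 : ((19 : ℝ) / 20) ^ (3 * k + 4) * 2 ^ k ≤ (19 / 20) ^ m * 2 ^ k :=
    mul_le_mul_of_nonneg_right h1 (by positivity)
  have h5 : (0 : ℝ) ≤ (19 / 20) ^ m * (39 / 40) ^ k := by positivity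
  nlinarith

/-- Both exponentials have one-step factor below `1`. For the first, narrowly: the upward drift of
`m` outweighs the growth of `(39/40)^k` as `k` falls. -/
theorem sum_decay_le (m k : ℤ) :
    ∑ c : Fin 3, ∑ s : Fin 3, ((![5, 6, 4] : Fin 3 → ℕ) c : ℝ) / 15 *
      (((![5, 6, 4] : Fin 3 → ℕ) s : ℝ) / 15 *
        decay (m + (![-1, 0, 1] c + ![0, 0, 1] s)) (k + (![0, 1, 0] c + ![-1, -1, 0] s))) ≤
      decay m k := by
  have h0 := decay_add m k 0 0
  rw [add_zero, add_zero] at h0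
  have h1 : (0 : ℝ) < (19 / 20) ^ m * (39 / 40) ^ k := by positivity
  have h2 : (0 : ℝ) < (19 / 20) ^ m * 2 ^ k := by positivity
  rw [h0]
  simp only [decay_add]
  generalize (19 / 20 : ℝ) ^ m * (39 / 40) ^ k = u at *
  generalize (19 / 20 : ℝ) ^ m * 2 ^ k = v at *
  simp [Fin.sum_univ_three, zpow_neg]
  norm_num
  linarith

/-- At `k = 0` the drift of `m` is downward; the loss is paid for by the drop of `(39/40)^k + 2^k /
200` when `k` moves to `1`. -/
theorem sum_decay_zero_le (m : ℤ) :
    ∑ c : Fin 3, ∑ s : Fin 3, ((![5, 6, 4] : Fin 3 → ℕ) c : ℝ) / 15 *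
      (((![5, 6, 4] : Fin 3 → ℕ) s : ℝ) / 15 *
        decay (m + (![-1, 0, 1] c + ![-1, 0, 1] s)) |![0, 1, 0] c - ![0, 1, 0] s|) ≤
      decay m 0 := by
  have h (j : ℤ) : decay (m + j) 0 =
      250 * (19 / 20) ^ m * ((19 / 20) ^ j * (1 + 1 / 200)) := by
    unfold decay
    rw [zpow_add₀ (by norm_num)]
    simp; ring
  have h' (j : ℤ) : decay (m + j) 1 =
      250 * (19 / 20) ^ m * ((19 / 20) ^ j * (39 / 40 + 2 / 200)) := by
    unfold decay
    rw [zpow_add₀ (by norm_num)]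
    simp; ring
  have h0 := h 0
  rw [add_zero] at h0
  have h1 : (0 : ℝ) < (19 / 20) ^ m := by positivity
  rw [h0]
  simp [Fin.sum_univ_three]
  simp only [h, h', h0]
  generalize (19 / 20 : ℝ) ^ m = u at *
  simp
  norm_num
  linarith

theorem mean_prodPMF_nnMarginal (f : Fin 3 → Fin 3 → ℝ) (hf : ∀ c s, 0 ≤ f c s) :
    mean (prodPMF nnMarginal nnMarginal) (fun a => ENNReal.ofReal (f a.1 a.2)) =
      ENNReal.ofReal (∑ c : Fin 3, ∑ s : Fin 3, ((![5, 6, 4] : Fin 3 → ℕ) c : ℝ) / 15 *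
        (((![5, 6, 4] : Fin 3 → ℕ) s : ℝ) / 15 * f c s)) := by
  have hw (i : Fin 3) :
      nnMarginal i = ENNReal.ofReal (((![5, 6, 4] : Fin 3 → ℕ) i : ℝ) / 15) := by
    rw [nnMarginal_apply, ENNReal.ofReal_div_of_pos (by norm_num), ENNReal.ofReal_natCast]
    simp
  have hw0 (i : Fin 3) : (0 : ℝ) ≤ ((![5, 6, 4] : Fin 3 → ℕ) i : ℝ) / 15 := by positivity
  have hterm (c s : Fin 3) : 0 ≤ ((![5, 6, 4] : Fin 3 → ℕ) s : ℝ) / 15 * f c s :=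
    mul_nonneg (hw0 s) (hf c s)
  rw [prodPMF, mean_bind]
  simp only [mean_map]
  simp only [mean, tsum_fintype, hw]
  rw [ENNReal.ofReal_sum_of_nonneg fun c _ =>
    Finset.sum_nonneg fun s _ => mul_nonneg (hw0 c) (hterm c s)]
  refine Finset.sum_congr rfl fun c _ => ?_
  rw [← Finset.mul_sum, ENNReal.ofReal_mul (hw0 c),
    ENNReal.ofReal_sum_of_nonneg fun s _ => hterm c s]
  congr 1
  exact Finset.sum_congr rfl fun s _ => (ENNReal.ofReal_mul (hw0 s)).symm

open Classical in
/-- A bounded superharmonic function for the chain, equal to `1` outside the region. -/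
noncomputable def escape (z : State nnGraph) : ℝ≥0∞ :=
  if InRegion z then min 1 (ENNReal.ofReal (decay (numThird z) (numSecond z))) else 1

theorem escape_le_one (z : State nnGraph) : escape z ≤ 1 := by
  unfold escape
  split_ifs <;> simp

theorem escape_ne_zero (z : State nnGraph) : escape z ≠ 0 := by
  unfold escape
  split_ifs
  · exact (lt_min one_pos (ENNReal.ofReal_pos.2 (decay_pos _ _))).ne'
  · exact one_ne_zero

theorem escape_le_decay {z : State nnGraph} (hz : InRegion z) :
    escape z ≤ ENNReal.ofReal (decay (numThird z) (numSecond z)) := by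
  rw [escape, if_pos hz]
  exact min_le_right _ _

theorem mean_chain_escape_le {pol : AdmissiblePolicy nnGraph} (hpol : PrefersSecond pol)
    (z : State nnGraph) :
    mean (chain pol (prodPMF nnMarginal nnMarginal) z) escape ≤ escape z := by
  -- Only states with `escape z < 1` matter; there the truncation at `1` is inactive.
  by_cases hone : escape z = 1
  · rw [hone]
    exact mean_le_of_le _ fun z' _ => escape_le_one z'
  have hz : InRegion z := by
    by_contra h
    exact hone (if_neg h)
  have hlt : decay (numThird z) (numSecond z) < 1 := by
    by_contra! h
    apply hone
    rw [escape, if_pos hz]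
    exact min_eq_left (ENNReal.one_le_ofReal.2 h)
  have hval : escape z = ENNReal.ofReal (decay (numThird z) (numSecond z)) := by
    rw [escape, if_pos hz]
    exact min_eq_right (ENNReal.ofReal_le_one.2 hlt.le)
  -- As `decay < 1`, `one_le_decay` forces `m > 3 * k + 4`. With the balance of customers and
  -- servers and one second class empty, this is exactly the margin `3` needed by
  -- `step_of_inRegion`.
  have hbig : 3 * (z.x 1 + z.y 1) + 4 < z.x 2 + z.y 2 := by
    by_contra! h
    have := one_le_decay h
    push_cast at this
    exact absurd hlt (not_lt.2 this)
  have hxy : z.x 1 = 0 ∨ z.y 1 = 0 := Nat.mul_eq_zero.1 (z.unmatched 1 1 (by decide))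
  have hbal := z.balanced
  rw [Fin.sum_univ_three, Fin.sum_univ_three, hz.1, hz.2.1] at hbal
  have hstep := fun (a : Fin 3 × Fin 3) z' (h : z' ∈ (step pol z a).support) =>
    step_of_inRegion hpol hz (by omega) (by omega) h
  have reduce : ∀ f : Fin 3 → Fin 3 → ℝ, (∀ c s, 0 ≤ f c s) →
      (∀ (a : Fin 3 × Fin 3) z', z' ∈ (step pol z a).support →
        decay (numThird z') (numSecond z') = f a.1 a.2) →
      (∑ c : Fin 3, ∑ s : Fin 3, ((![5, 6, 4] : Fin 3 → ℕ) c : ℝ) / 15 *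
        (((![5, 6, 4] : Fin 3 → ℕ) s : ℝ) / 15 * f c s)) ≤
        decay (numThird z) (numSecond z) →
      mean (chain pol (prodPMF nnMarginal nnMarginal) z) escape ≤ escape z := by
    intro f hf hdec hsum
    rw [hval, chain, mean_bind]
    refine le_trans ?_ (ENNReal.ofReal_le_ofReal hsum)
    rw [← mean_prodPMF_nnMarginal f hf]
    refine mean_le_mean _ fun a _ => mean_le_of_le _ fun z' hz' => ?_
    rw [← hdec a z' hz']
    exact escape_le_decay (hstep a z' hz').1
  rcases Nat.eq_zero_or_pos (z.x 1) with hx | hx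
  · rcases Nat.eq_zero_or_pos (z.y 1) with hy | hy
    · refine reduce (fun c s => decay (numThird z + (![-1, 0, 1] c + ![-1, 0, 1] s))
        |![0, 1, 0] c - ![0, 1, 0] s|) (fun c s => (decay_pos _ _).le) (fun a z' h => ?_) ?_
      · obtain ⟨h1, h2⟩ := (hstep a z' h).2.2.2 hx hy
        rw [h1, h2]
      · have : numSecond z = 0 := by simp [numSecond, hx, hy]
        rw [this]
        exact sum_decay_zero_le _
    · refine reduce (fun c s => decay (numThird z + (![0, 0, 1] c + ![-1, 0, 1] s))
        (numSecond z + (![-1, -1, 0] c + ![0, 1, 0] s)))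
        (fun c s => (decay_pos _ _).le) (fun a z' h => ?_) ?_
      · obtain ⟨h1, h2⟩ := (hstep a z' h).2.2.1 hy
        rw [h1, h2]
      -- Waiting second-class servers mirror waiting second-class customers, the marginals being
      -- equal.
      · rw [Finset.sum_comm]
        refine le_of_eq_of_le ?_ (sum_decay_le (numThird z) (numSecond z))
        refine Finset.sum_congr rfl fun c _ => Finset.sum_congr rfl fun s _ => ?_
        rw [mul_left_comm, add_comm (![0, 0, 1] s : ℤ), add_comm (![-1, -1, 0] s : ℤ)]
  · refine reduce (fun c s => decay (numThird z + (![-1, 0, 1] c + ![0, 0, 1] s))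
      (numSecond z + (![0, 1, 0] c + ![-1, -1, 0] s)))
      (fun c s => (decay_pos _ _).le) (fun a z' h => ?_) (sum_decay_le _ _)
    obtain ⟨h1, h2⟩ := (hstep a z' h).2.1 hx
    rw [h1, h2]

/-- Buffers of `n` customers and `n` servers of the third classes have `m = 2 * n` and `k = 0`, and
`decay` tends to zero along them. -/
theorem exists_escape_lt {ε : ℝ≥0∞} (hε : 0 < ε) : ∃ z, escape z < ε := by
  have hlim : Filter.Tendsto (fun n : ℕ => ENNReal.ofReal (decay (2 * n : ℕ) 0)) Filter.atTop
      (nhds 0) := by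
    rw [← ENNReal.ofReal_zero]
    refine ENNReal.tendsto_ofReal ?_
    have h := (tendsto_pow_atTop_nhds_zero_of_lt_one (r := ((19 : ℝ) / 20) ^ 2) (by norm_num)
      (by norm_num)).const_mul (250 * (1 + 1 / 200))
    rw [mul_zero] at h
    refine h.congr fun n => ?_
    rw [decay, zpow_natCast, pow_mul]
    simp; ring
  obtain ⟨n, hn, hpos⟩ := ((hlim.eventually_lt_const hε).and (Filter.eventually_gt_atTop 0)).exists
  refine ⟨⟨Pi.single 2 n, Pi.single 2 n, rfl, fun c s h => ?_⟩, ?_⟩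
  · fin_cases c <;> fin_cases s <;> simp [nnGraph] at h ⊢
  refine (escape_le_decay ?_).trans_lt (lt_of_eq_of_lt ?_ hn)
  · simpa [InRegion] using hpos
  · simp [numThird, numSecond, two_mul]

theorem not_isStable_nnGraph {pol : AdmissiblePolicy nnGraph} (hpol : PrefersSecond pol) :
    ¬ IsStable (chain pol (prodPMF nnMarginal nnMarginal)) :=
  not_isStable_of_superharmonic escape_le_one escape_ne_zero (mean_chain_escape_le hpol)
    fun _ => exists_escape_lt

theorem stabilityRegion_ssubset_ncondRegion {pol : AdmissiblePolicy nnGraph}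
    (hpol : PrefersSecond pol) : stabilityRegion pol ⊂ ncondRegion nnGraph :=
  (Set.ssubset_iff_of_subset (stabilityRegion_subset_ncondRegion pol)).2
    ⟨_, prodPMF_nnMarginal_mem_ncondRegion, fun h => not_isStable_nnGraph hpol h.2.2⟩

end Escape

end BipartiteMatching

theorem mainTheorem2 :
    (stabilityRegion (matchShortest nnGraph) ⊂ ncondRegion nnGraph ∧
      stabilityRegion (priority nnGraph nnPriority nnPriority) ⊂ ncondRegion nnGraph) ∧
    prodPMF nnMarginal nnMarginal ∈ ncondRegion nnGraph ∧
    ¬ IsStable (chain (matchShortest nnGraph) (prodPMF nnMarginal nnMarginal)) ∧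
    ¬ IsStable (chain (priority nnGraph nnPriority nnPriority)
        (prodPMF nnMarginal nnMarginal)) :=
  ⟨⟨stabilityRegion_ssubset_ncondRegion prefersSecond_matchShortest,
    stabilityRegion_ssubset_ncondRegion prefersSecond_priority⟩,
    prodPMF_nnMarginal_mem_ncondRegion,
    not_isStable_nnGraph prefersSecond_matchShortest,
    not_isStable_nnGraph prefersSecond_priority⟩
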